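/- **Completeness for bi-infinite words.** Let $\mathbf{FinRel}$ be the category of finite sets (the empty set included) and relations, with the Cartesian product $\times$ as monoidal product and the one-point set $\mathbb 1$ as unit; $f;g$ denotes $f$ followed by $g$, and $\gamma_{A,B}:A\times B\to B\times A$ is the swap. *Diagrams.* The diagrams $A\to B$ of $\mathbb Z\text{-}\mathbf{Trans}$, with $A,B$ finite sets, are generated by identities $\mathrm{id}_A$, swaps $\gamma_{A,B}$, a box $[\mathcal R]:A\to B$ for every relation $\mathcal R:A\to B$ in $\mathbf{FinRel}$, sequential composition $f;g$, parallel composition $f\times g$, and feedback, which turns a diagram $f:A\times C\to B\times C$ into a diagram $\mathrm{fb}_C(f):A\to B$. The identifications $(A\times B)\times C=A\times(B\times C)$ and $\mathbb 1\times A=A=A\times\mathbb 1$ are left implicit. *Semantics.* A diagram $f:A\to B$ denotes a relation $\llbracket f\rrbracket$ between $A^{\mathbb Z}$ and $B^{\mathbb Z}$. Words over a product are identified with tuples of words. Identities, swaps, $;$ and $\times$ have their usual meaning for relations; $x\,\llbracket[\mathcal R]\rrbracket\,y$ iff $x_k\,\mathcal R\,y_k$ for all $k\in\mathbb Z$; and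 $x\,\llbracket\mathrm{fb}_C(f)\rrbracket\,y$ iff there are $u,t\in C^{\mathbb Z}$ with $(x,u)\,\llbracket f\rrbracket\,(y,t)$ and $u_{k+1}=t_k$ for all $k\in\mathbb Z$. *Equational theory.* It is the smallest congruence on diagrams (an equivalence relation between diagrams of the same type, compatible with $;$, $\times$ and feedback) that contains the following equations. 1. The equations of a strict symmetric monoidal category. 2. The equations of a feedback category: - $f;\mathrm{fb}_C(g);h=\mathrm{fb}_C\big((f\times \mathrm{id}_C);g;(h\times\mathrm{id}_C)\big)$, - $\mathrm{fb}_{\mathbb 1}(f)=f$, - $f\times \mathrm{fb}_C(g)=\mathrm{fb}_C(f\times g)$, - $\mathrm{fb}_C(\mathrm{fb}_D(f))=\mathrm{fb}_{C\times D}(f)$. 3. The embedding of $\mathbf{FinRel}$: $[\mathrm{id}_A]=\mathrm{id}_A$, $[\gamma_{A,B}]=\gamma_{A,B}$, $[\mathcal R];[\mathcal S]=[\mathcal R;\mathcal S]$, $[\mathcal R]\times[\mathcal S]=[\mathcal R\times\mathcal S]$. 4. The bi-infinite simulation principle: $\mathrm{fb}_C([\mathcal R])=\mathrm{fb}_D([\mathcal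 T])$ for all relations $\mathcal R:A\times C\to B\times C$ and $\mathcal T:A\times D\to B\times D$ for which there is a relation $\mathcal S:C\to D$ such that - $\mathcal R;(\mathrm{id}_B\times\mathcal S)=(\mathrm{id}_A\times\mathcal S);\mathcal T$, - for some $n\in\mathbb N$, every state $d\in D$ at the end of a path of length $n$ of $\mathcal T$ satisfies $c\,\mathcal S\,d$ for some $c\in C$, - for some $n\in\mathbb N$, every state $c\in C$ at the start of a path of length $n$ of $\mathcal R$ satisfies $c\,\mathcal S\,d$ for some $d\in D$. Here a path of length $n$ of $\mathcal R$ is a sequence $c_0,\dots,c_n$ of states such that for each $i<n$ there are letters $a\in A$, $b\in B$ with $(a,c_i)\,\mathcal R\,(b,c_{i+1})$, and similarly for $\mathcal T$. **Theorem.** Let $A$ and $B$ be finite sets and let $R,S:A\to B$ be diagrams of $\mathbb Z\text{-}\mathbf{Trans}$. If $\llbracket R\rrbracket=\llbracket S\rrbracket$ as relations between $A^{\mathbb Z}$ and $B^{\mathbb Z}$, then $R=S$ follows from the equational theory. -/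

import Mathlib

universe u

namespace ZTrans

/-- The objects: finite sets. -/
structure Obj : Type (u + 1) where
  carrier : Type u
  finite : Finite carrier

instance : CoeSort Obj.{u} (Type u) := ⟨Obj.carrier⟩

instance (A : Obj.{u}) : Finite A := A.finite

/-- The Cartesian product of finite sets. -/
abbrev Obj.prod (A B : Obj.{u}) : Obj.{u} := ⟨A × B, inferInstance⟩

/-- The one-point set, the neutral element of the product. -/
abbrev Obj.one : Obj.{u} := ⟨PUnit.{u + 1}, inferInstance⟩

/-! ### The category of finite sets and relations -/

/-- Relations between two finite sets, the morphisms of `FinRel`. They are composed with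
`Relation.Comp` (first argument first) and the identity is equality. -/
abbrev FinRel (A B : Obj.{u}) : Type u := A → B → Prop

/-- The Cartesian product of two relations. -/
def prodRel {A B C D : Obj.{u}} (R : FinRel A B) (S : FinRel C D) :
    FinRel (A.prod C) (B.prod D) :=
  fun x y => R x.1 y.1 ∧ S x.2 y.2

/-- The relation which swaps two components. -/
def swapRel (A B : Obj.{u}) : FinRel (A.prod B) (B.prod A) :=
  fun x y => y = (x.2, x.1)

/-- The identification of `(A × B) × C` with `A × (B × C)`. -/
def assocRel (A B C : Obj.{u}) : FinRel ((A.prod B).prod C) (A.prod (B.prod C)) :=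
  fun x y => y = (x.1.1, (x.1.2, x.2))

/-- The identification of `A × (B × C)` with `(A × B) × C`. -/
def assocInvRel (A B C : Obj.{u}) : FinRel (A.prod (B.prod C)) ((A.prod B).prod C) :=
  fun x y => y = ((x.1, x.2.1), x.2.2)

/-- The identification of `1 × A` with `A`. -/
def lunitRel (A : Obj.{u}) : FinRel (Obj.one.prod A) A := fun x y => y = x.2

/-- The identification of `A × 1` with `A`. -/
def runitRel (A : Obj.{u}) : FinRel (A.prod Obj.one) A := fun x y => y = x.1

/-- The identification of `A` with `A × 1`. -/
def runitInvRel (A : Obj.{u}) : FinRel A (A.prod Obj.one) := fun x y => y = (x, PUnit.unit)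

/-! ### Diagrams -/

/-- The diagrams of the graphical language: wires, crossings and boxes labelled by a relation of
`FinRel`, composed sequentially (`comp f g` is `f` followed by `g`), in parallel, and with
feedback on the last wire. The identifications `(A × B) × C = A × (B × C)` and
`1 × A = A = A × 1` of a strict monoidal category are witnessed by boxes. -/
inductive Diagram : Obj.{u} → Obj.{u} → Type (u + 1)
  | id (A : Obj.{u}) : Diagram A A
  | swap (A B : Obj.{u}) : Diagram (A.prod B) (B.prod A)
  | box {A B : Obj.{u}} (R : FinRel A B) : Diagram A B
  | comp {A B C : Obj.{u}} (f : Diagram A B) (g : Diagram B C) : Diagram A C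
  | tensor {A B C D : Obj.{u}} (f : Diagram A B) (g : Diagram C D) :
      Diagram (A.prod C) (B.prod D)
  | feedback {A B : Obj.{u}} (C : Obj.{u}) (f : Diagram (A.prod C) (B.prod C)) : Diagram A B

/-! ### Semantics on bi-infinite words -/

/-- Bi-infinite words over `A`. -/
abbrev Word (A : Type u) : Type u := ℤ → A

/-- The delay relation: `t` is related to `u` when `u` is `t` delayed by one position. -/
def shift {C : Type u} (t u : Word C) : Prop := ∀ k : ℤ, u (k + 1) = t k

/-- The semantics of a diagram from `A` to `B` as a relation between bi-infinite words over `A`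
and over `B`; a word over `A × B` is identified with a pair of words over `A` and over `B`. -/
def Diagram.sem : {A B : Obj.{u}} → Diagram A B → Word A → Word B → Prop
  | _, _, .id _ => fun x y => x = y
  | _, _, .swap _ _ => fun x y => ∀ k, y k = ((x k).2, (x k).1)
  | _, _, .box R => fun x y => ∀ k, R (x k) (y k)
  | _, _, .comp f g => fun x z => ∃ y, f.sem x y ∧ g.sem y z
  | _, _, .tensor f g => fun x y =>
      f.sem (fun k => (x k).1) (fun k => (y k).1) ∧ g.sem (fun k => (x k).2) (fun k => (y k).2)
  | _, _, .feedback C f => fun x y =>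
      ∃ u t : Word C, f.sem (fun k => (x k, u k)) (fun k => (y k, t k)) ∧ shift t u

/-! ### The bi-infinite simulation principle -/

/-- One step between states of a transducer, whatever the input and output letters. -/
def stateStep {A B C : Obj.{u}} (R : FinRel (A.prod C) (B.prod C)) : FinRel C C :=
  fun c c' => ∃ a b, R (a, c) (b, c')

/-- `statePath R n c c'` holds if there is a path of length `n` from the state `c` to `c'`. -/
def statePath {A B C : Obj.{u}} (R : FinRel (A.prod C) (B.prod C)) : ℕ → FinRel C C
  | 0 => Eq
  | n + 1 => Relation.Comp (statePath R n) (stateStep R)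

/-- The premises of the simulation principle for bi-infinite words: the relation `S` slides
through the transition relations `R` and `T`, and, for some length `n`, it relates every state of
`T` which ends a path of length `n` and every state of `R` which starts a path of length `n`. -/
structure IsSimulation {A B C D : Obj.{u}} (R : FinRel (A.prod C) (B.prod C))
    (T : FinRel (A.prod D) (B.prod D)) (S : FinRel C D) : Prop where
  slide : Relation.Comp R (prodRel (A := B) (B := B) Eq S) =
    Relation.Comp (prodRel (A := A) (B := A) Eq S) T
  ends : ∃ n : ℕ, ∀ d' d, statePath T n d' d → ∃ c, S c d
  starts : ∃ n : ℕ, ∀ c c', statePath R n c c' → ∃ d, S c d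

/-! ### The equational theory -/

open Diagram in
/-- `Derivable f g`: the equation `f = g` between diagrams follows from the equational theory. -/
inductive Derivable : {A B : Obj.{u}} → Diagram A B → Diagram A B → Prop
  -- equational reasoning inside arbitrary diagrams
  | refl {A B : Obj.{u}} (f : Diagram A B) : Derivable f f
  | symm {A B : Obj.{u}} {f g : Diagram A B} : Derivable f g → Derivable g f
  | trans {A B : Obj.{u}} {f g h : Diagram A B} : Derivable f g → Derivable g h → Derivable f h
  | congr_comp {A B C : Obj.{u}} {f f' : Diagram A B} {g g' : Diagram B C} :
      Derivable f f' → Derivable g g' → Derivable (comp f g) (comp f' g')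
  | congr_tensor {A B C D : Obj.{u}} {f f' : Diagram A B} {g g' : Diagram C D} :
      Derivable f f' → Derivable g g' → Derivable (tensor f g) (tensor f' g')
  | congr_feedback {A B C : Obj.{u}} {f f' : Diagram (A.prod C) (B.prod C)} :
      Derivable f f' → Derivable (feedback C f) (feedback C f')
  -- symmetric monoidal category
  | id_comp {A B : Obj.{u}} (f : Diagram A B) : Derivable (comp (id A) f) f
  | comp_id {A B : Obj.{u}} (f : Diagram A B) : Derivable (comp f (id B)) f
  | comp_assoc {A B C D : Obj.{u}} (f : Diagram A B) (g : Diagram B C) (h : Diagram C D) :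
      Derivable (comp (comp f g) h) (comp f (comp g h))
  | tensor_id (A B : Obj.{u}) : Derivable (tensor (id A) (id B)) (id (A.prod B))
  | interchange {A B C A' B' C' : Obj.{u}} (f : Diagram A B) (g : Diagram B C)
      (f' : Diagram A' B') (g' : Diagram B' C') :
      Derivable (tensor (comp f g) (comp f' g')) (comp (tensor f f') (tensor g g'))
  | tensor_assoc {A B C A' B' C' : Obj.{u}} (f : Diagram A A') (g : Diagram B B')
      (h : Diagram C C') :
      Derivable (comp (tensor (tensor f g) h) (box (assocRel A' B' C')))
        (comp (box (assocRel A B C)) (tensor f (tensor g h)))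
  | one_tensor {A B : Obj.{u}} (f : Diagram A B) :
      Derivable (comp (tensor (id Obj.one) f) (box (lunitRel B))) (comp (box (lunitRel A)) f)
  | tensor_one {A B : Obj.{u}} (f : Diagram A B) :
      Derivable (comp (tensor f (id Obj.one)) (box (runitRel B))) (comp (box (runitRel A)) f)
  | swap_swap (A B : Obj.{u}) : Derivable (comp (swap A B) (swap B A)) (id (A.prod B))
  | swap_natural {A B C D : Obj.{u}} (f : Diagram A B) (g : Diagram C D) :
      Derivable (comp (tensor f g) (swap B D)) (comp (swap A C) (tensor g f))
  -- feedback category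
  | feedback_tighten {A A' B B' C : Obj.{u}} (f : Diagram A' A)
      (g : Diagram (A.prod C) (B.prod C)) (h : Diagram B B') :
      Derivable (comp (comp f (feedback C g)) h)
        (feedback C (comp (comp (tensor f (id C)) g) (tensor h (id C))))
  | feedback_one {A B : Obj.{u}} (f : Diagram (A.prod Obj.one) (B.prod Obj.one)) :
      Derivable (feedback Obj.one f) (comp (comp (box (runitInvRel A)) f) (box (runitRel B)))
  | feedback_tensor {A B C A' B' : Obj.{u}} (f : Diagram A' B')
      (g : Diagram (A.prod C) (B.prod C)) :
      Derivable (tensor f (feedback C g))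
        (feedback C (comp (comp (box (assocRel A' A C)) (tensor f g)) (box (assocInvRel B' B C))))
  | feedback_feedback {A B C D : Obj.{u}}
      (f : Diagram ((A.prod C).prod D) ((B.prod C).prod D)) :
      Derivable (feedback C (feedback D f))
        (feedback (C.prod D) (comp (comp (box (assocInvRel A C D)) f) (box (assocRel B C D))))
  -- embedding of `FinRel`
  | box_id (A : Obj.{u}) : Derivable (box (A := A) (B := A) Eq) (id A)
  | box_swap (A B : Obj.{u}) : Derivable (box (swapRel A B)) (swap A B)
  | box_comp {A B C : Obj.{u}} (R : FinRel A B) (S : FinRel B C) :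
      Derivable (comp (box R) (box S)) (box (Relation.Comp R S))
  | box_tensor {A B C D : Obj.{u}} (R : FinRel A B) (S : FinRel C D) :
      Derivable (tensor (box R) (box S)) (box (prodRel R S))
  -- bi-infinite simulation principle
  | simulation {A B C D : Obj.{u}} {R : FinRel (A.prod C) (B.prod C)}
      {T : FinRel (A.prod D) (B.prod D)} {S : FinRel C D} (h : IsSimulation R T S) :
      Derivable (feedback C (box R)) (feedback D (box T))

end ZTrans

namespace ZTrans

open Diagram

/-! ### Normal forms -/

/-! Every diagram is provably equal to one transducer `fb_C([R])` with the same semantics, so only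
transducers matter. Over the alphabet A × B, the relation L denoted by a transducer determines a
canonical deterministic machine, whose states are the nonempty residuals of L by left-infinite
words. A residual is the future of the set of states reached by the word, so there are finitely
many. The determinization, on nonempty reached sets, links the two: membership simulates it in the
original transducer (`isSimulation_detSim`), and taking futures simulates it in the canonical one
(`isSimulation_futureSim`). The bounded-path premises suffice because, in a finite graph, long
enough paths extend to infinite ones. -/

theorem Derivable.of_box_eq {A B : Obj.{u}} {R S : FinRel A B} (h : R = S) :
    Derivable (box R) (box S) := h ▸ .refl _

/-- Runs of a transducer: the semantics of `feedback C (box R)`. -/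
def HasRun {A B C : Obj.{u}} (R : FinRel (A.prod C) (B.prod C)) (x : Word A) (y : Word B) : Prop :=
  ∃ u : Word C, ∀ k, R (x k, u k) (y k, u (k + 1))

theorem feedback_box_comp_box {A B B' C : Obj.{u}} (R : FinRel (A.prod C) (B.prod C))
    (T : FinRel B B') :
    Derivable (comp (feedback C (box R)) (box T))
      (feedback C (box (Relation.Comp R (prodRel (C := C) (D := C) T Eq)))) := by
  refine (Derivable.congr_comp (.symm (.id_comp _)) (.refl _)).trans ?_
  refine (Derivable.feedback_tighten _ _ _).trans (.congr_feedback ?_)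
  refine (Derivable.congr_comp ((Derivable.congr_comp (.tensor_id _ _) (.refl _)).trans
    (.id_comp _)) ((Derivable.congr_tensor (.refl _) (.symm (.box_id _))).trans
    (.box_tensor _ _))).trans (.box_comp _ _)

theorem box_comp_feedback_box {A A' B C : Obj.{u}} (R : FinRel (A.prod C) (B.prod C))
    (T : FinRel A' A) :
    Derivable (comp (box T) (feedback C (box R)))
      (feedback C (box (Relation.Comp (prodRel (C := C) (D := C) T Eq) R))) := by
  refine (Derivable.symm (.comp_id _)).trans ?_
  refine (Derivable.feedback_tighten _ _ _).trans (.congr_feedback ?_)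
  refine (Derivable.congr_comp (.refl _) (.tensor_id _ _)).trans ((Derivable.comp_id _).trans ?_)
  exact (Derivable.congr_comp ((Derivable.congr_tensor (.refl _) (.symm (.box_id _))).trans
    (.box_tensor _ _)) (.refl _)).trans (.box_comp _ _)

/-- The transition relation of a transducer in parallel with a wire on its left. -/
def idTensor {A B C : Obj.{u}} (D : Obj.{u}) (R : FinRel (A.prod C) (B.prod C)) :
    FinRel ((D.prod A).prod C) ((D.prod B).prod C) :=
  fun x y => x.1.1 = y.1.1 ∧ R (x.1.2, x.2) (y.1.2, y.2)

/-- The transition relation of a transducer in parallel with a wire on its right. -/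
def tensorId {A B C : Obj.{u}} (R : FinRel (A.prod C) (B.prod C)) (D : Obj.{u}) :
    FinRel ((A.prod D).prod C) ((B.prod D).prod C) :=
  fun x y => R (x.1.1, x.2) (y.1.1, y.2) ∧ x.1.2 = y.1.2

theorem id_tensor_feedback_box {A B C : Obj.{u}} (D : Obj.{u})
    (R : FinRel (A.prod C) (B.prod C)) :
    Derivable (tensor (id D) (feedback C (box R))) (feedback C (box (idTensor D R))) := by
  refine (Derivable.feedback_tensor _ _).trans (.congr_feedback ?_)
  refine (Derivable.congr_comp ((Derivable.congr_comp (.refl _)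
    ((Derivable.congr_tensor (.symm (.box_id _)) (.refl _)).trans (.box_tensor _ _))).trans
    (.box_comp _ _)) (.refl _)).trans ((Derivable.box_comp _ _).trans (.of_box_eq ?_))
  ext ⟨⟨d, a⟩, c⟩ ⟨⟨d', b⟩, c'⟩
  simp [Relation.Comp, assocRel, assocInvRel, prodRel, idTensor]

/-- The axiom only lets a feedback absorb a diagram on its left, so the wire is moved to that side
by conjugating with swaps. -/
theorem feedback_box_tensor_id {A B C : Obj.{u}} (D : Obj.{u})
    (R : FinRel (A.prod C) (B.prod C)) :
    Derivable (tensor (feedback C (box R)) (id D)) (feedback C (box (tensorId R D))) := by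
  have h : Derivable (tensor (feedback C (box R)) (id D))
      (comp (box (swapRel A D)) (comp (tensor (id D) (feedback C (box R)))
        (box (swapRel D B)))) := by
    refine (Derivable.symm ?_)
    refine (Derivable.congr_comp (.box_swap _ _) (.congr_comp (.refl _) (.box_swap _ _))).trans ?_
    refine (Derivable.congr_comp (.refl _) (.swap_natural _ _)).trans ?_
    refine (Derivable.symm (.comp_assoc _ _ _)).trans ?_
    exact (Derivable.congr_comp (.swap_swap _ _) (.refl _)).trans (.id_comp _)
  refine h.trans ((Derivable.congr_comp (.refl _) ((Derivable.congr_comp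
    (id_tensor_feedback_box D R) (.refl _)).trans (feedback_box_comp_box _ _))).trans
    ((box_comp_feedback_box _ _).trans (.congr_feedback (.of_box_eq ?_))))
  ext ⟨⟨a, d⟩, c⟩ ⟨⟨b, d'⟩, c'⟩
  simp [Relation.Comp, swapRel, prodRel, idTensor, tensorId]
  grind

/-- The transition relation of a transducer with one more wire fed back. -/
def nestFeedback {A B C D : Obj.{u}} (R : FinRel ((A.prod C).prod D) ((B.prod C).prod D)) :
    FinRel (A.prod (C.prod D)) (B.prod (C.prod D)) :=
  fun x y => R ((x.1, x.2.1), x.2.2) ((y.1, y.2.1), y.2.2)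

theorem feedback_feedback_box {A B C D : Obj.{u}}
    (R : FinRel ((A.prod C).prod D) ((B.prod C).prod D)) :
    Derivable (feedback C (feedback D (box R))) (feedback (C.prod D) (box (nestFeedback R))) := by
  refine (Derivable.feedback_feedback _).trans (.congr_feedback ?_)
  refine (Derivable.congr_comp (.box_comp _ _) (.refl _)).trans
    ((Derivable.box_comp _ _).trans (.of_box_eq ?_))
  ext ⟨a, c, d⟩ ⟨b, c', d'⟩
  simp [Relation.Comp, assocRel, assocInvRel, nestFeedback]

/-- The transition relation of the sequential composition of two transducers. -/
def seqRel {A B E C D : Obj.{u}} (R : FinRel (A.prod C) (B.prod C))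
    (T : FinRel (B.prod D) (E.prod D)) : FinRel (A.prod (D.prod C)) (E.prod (D.prod C)) :=
  fun x y => ∃ b, R (x.1, x.2.2) (b, y.2.2) ∧ T (b, x.2.1) (y.1, y.2.1)

/-- Tightening pulls the first transducer inside the loop of the second. Its own loop becomes the
inner one, whence the state order D × C after merging. -/
theorem feedback_box_comp_feedback_box {A B E C D : Obj.{u}} (R : FinRel (A.prod C) (B.prod C))
    (T : FinRel (B.prod D) (E.prod D)) :
    Derivable (comp (feedback C (box R)) (feedback D (box T)))
      (feedback (D.prod C) (box (seqRel R T))) := by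
  refine (Derivable.symm (.comp_id _)).trans ((Derivable.feedback_tighten _ _ _).trans ?_)
  refine (Derivable.congr_feedback ((Derivable.congr_comp (.congr_comp
    (feedback_box_tensor_id _ _) (.refl _)) (.tensor_id _ _)).trans
    ((Derivable.comp_id _).trans (feedback_box_comp_box _ _)))).trans ?_
  refine (feedback_feedback_box _).trans (.congr_feedback (.of_box_eq ?_))
  ext ⟨a, d, c⟩ ⟨e, d', c'⟩
  simp [Relation.Comp, prodRel, tensorId, nestFeedback, seqRel]

/-- A diagram is equivalent to a transducer, both in the equational theory and semantically. -/
def HasNormalForm {A B : Obj.{u}} (f : Diagram A B) : Prop :=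
  ∃ (C : Obj.{u}) (R : FinRel (A.prod C) (B.prod C)), Derivable f (feedback C (box R)) ∧
    ∀ x y, f.sem x y ↔ HasRun R x y

theorem HasNormalForm.of_derivable {A B : Obj.{u}} {f g : Diagram A B} (hg : HasNormalForm g)
    (h : Derivable f g) (hs : ∀ x y, f.sem x y ↔ g.sem x y) : HasNormalForm f := by
  obtain ⟨C, R, hR, hR'⟩ := hg
  exact ⟨C, R, h.trans hR, fun x y => (hs x y).trans (hR' x y)⟩

theorem hasNormalForm_box {A B : Obj.{u}} (R : FinRel A B) : HasNormalForm (box R) := by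
  refine ⟨Obj.one, fun x y => R x.1 y.1, ?_, fun x y => ?_⟩
  · refine Derivable.symm ((Derivable.feedback_one _).trans ?_)
    refine (Derivable.congr_comp (.box_comp _ _) (.refl _)).trans
      ((Derivable.box_comp _ _).trans (.of_box_eq ?_))
    ext a b
    simp [Relation.Comp, runitRel, runitInvRel]
  · exact ⟨fun h => ⟨fun _ => PUnit.unit, h⟩, fun ⟨_, h⟩ => h⟩

theorem HasNormalForm.comp {A B E : Obj.{u}} {f : Diagram A B} {g : Diagram B E}
    (hf : HasNormalForm f) (hg : HasNormalForm g) : HasNormalForm (comp f g) := by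
  obtain ⟨C, R, hR, hR'⟩ := hf
  obtain ⟨D, T, hT, hT'⟩ := hg
  refine ⟨_, _, (Derivable.congr_comp hR hT).trans (feedback_box_comp_feedback_box R T),
    fun x z => ⟨?_, ?_⟩⟩
  · rintro ⟨y, h₁, h₂⟩
    obtain ⟨v, hv⟩ := (hR' _ _).1 h₁
    obtain ⟨w, hw⟩ := (hT' _ _).1 h₂
    exact ⟨fun k => (w k, v k), fun k => ⟨y k, hv k, hw k⟩⟩
  · rintro ⟨v, hv⟩
    choose y h₁ h₂ using hv
    exact ⟨y, (hR' _ _).2 ⟨fun k => (v k).2, h₁⟩, (hT' _ _).2 ⟨fun k => (v k).1, h₂⟩⟩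

theorem HasNormalForm.tensor_id {A B : Obj.{u}} {f : Diagram A B} (hf : HasNormalForm f)
    (D : Obj.{u}) : HasNormalForm (tensor f (id D)) := by
  obtain ⟨C, R, hR, hR'⟩ := hf
  refine ⟨_, _, (Derivable.congr_tensor hR (.refl _)).trans (feedback_box_tensor_id D R),
    fun x y => ⟨?_, ?_⟩⟩
  · rintro ⟨h₁, h₂⟩
    obtain ⟨v, hv⟩ := (hR' _ _).1 h₁
    exact ⟨v, fun k => ⟨hv k, congrFun h₂ k⟩⟩
  · rintro ⟨v, hv⟩
    exact ⟨(hR' _ _).2 ⟨v, fun k => (hv k).1⟩, funext fun k => (hv k).2⟩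

theorem HasNormalForm.id_tensor {A B : Obj.{u}} {f : Diagram A B} (hf : HasNormalForm f)
    (D : Obj.{u}) : HasNormalForm (tensor (id D) f) := by
  obtain ⟨C, R, hR, hR'⟩ := hf
  refine ⟨_, _, (Derivable.congr_tensor (.refl _) hR).trans (id_tensor_feedback_box D R),
    fun x y => ⟨?_, ?_⟩⟩
  · rintro ⟨h₂, h₁⟩
    obtain ⟨v, hv⟩ := (hR' _ _).1 h₁
    exact ⟨v, fun k => ⟨congrFun h₂ k, hv k⟩⟩
  · rintro ⟨v, hv⟩
    exact ⟨funext fun k => (hv k).1, (hR' _ _).2 ⟨v, fun k => (hv k).2⟩⟩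

theorem HasNormalForm.tensor {A B A' B' : Obj.{u}} {f : Diagram A B} {g : Diagram A' B'}
    (hf : HasNormalForm f) (hg : HasNormalForm g) : HasNormalForm (tensor f g) := by
  refine ((hf.tensor_id A').comp (hg.id_tensor B)).of_derivable ?_ fun x y => ⟨?_, ?_⟩
  · exact (Derivable.congr_tensor (.symm (.comp_id _)) (.symm (.id_comp _))).trans
      (.interchange _ _ _ _)
  · rintro ⟨h₁, h₂⟩
    exact ⟨fun k => ((y k).1, (x k).2), ⟨h₁, rfl⟩, rfl, h₂⟩
  · rintro ⟨z, ⟨h₁, h₂⟩, h₃, h₄⟩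
    exact ⟨h₃ ▸ h₁, Eq.symm h₂ ▸ h₄⟩

theorem HasNormalForm.feedback {A B C : Obj.{u}} {f : Diagram (A.prod C) (B.prod C)}
    (hf : HasNormalForm f) : HasNormalForm (feedback C f) := by
  obtain ⟨D, R, hR, hR'⟩ := hf
  refine ⟨_, _, (Derivable.congr_feedback hR).trans (feedback_feedback_box R),
    fun x y => ⟨?_, ?_⟩⟩
  · rintro ⟨v, t, h, hs⟩
    obtain ⟨w, hw⟩ := (hR' _ _).1 h
    refine ⟨fun k => (v k, w k), fun k => ?_⟩
    have := hw k
    simp only [← hs k] at this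
    exact this
  · rintro ⟨v, hv⟩
    exact ⟨fun k => (v k).1, fun k => (v (k + 1)).1,
      (hR' _ _).2 ⟨fun k => (v k).2, hv⟩, fun _ => rfl⟩

/-- Carrying the semantics through the induction makes a separate soundness theorem unnecessary. -/
theorem hasNormalForm {A B : Obj.{u}} (f : Diagram A B) : HasNormalForm f := by
  induction f with
  | id A =>
    exact (hasNormalForm_box _).of_derivable (.symm (.box_id A)) fun x y => funext_iff
  | swap A B =>
    exact (hasNormalForm_box _).of_derivable (.symm (.box_swap A B)) fun x y => Iff.rfl
  | box R => exact hasNormalForm_box R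
  | comp f g hf hg => exact hf.comp hg
  | tensor f g hf hg => exact hf.tensor hg
  | feedback C f hf => exact hf.feedback

/-! ### Long paths in finite graphs -/

/-- In a finite graph, a vertex at the start of sufficiently long paths, where `P n` is the set of
starts of paths of length `n`, is at the start of an infinite path. -/
theorem exists_infinite_path {C : Type*} [Finite C] {r : C → C → Prop} {P : ℕ → C → Prop}
    (h0 : ∀ c, P 0 c) (hP : ∀ n c, P (n + 1) c ↔ ∃ d, r c d ∧ P n d) :
    ∃ n, ∀ c, P n c → ∃ p : ℕ → C, p 0 = c ∧ ∀ k, r (p k) (p (k + 1)) := by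
  have hanti : ∀ n c, P (n + 1) c → P n c := by
    intro n
    induction n with
    | zero => exact fun c _ => h0 c
    | succ n ih =>
      intro c h
      obtain ⟨d, hd, h⟩ := (hP _ _).1 h
      exact (hP _ _).2 ⟨d, hd, ih d h⟩
  have ha : Antitone fun n => {c | P n c} := antitone_nat_of_succ_le hanti
  -- A decreasing chain of subsets of a finite set stabilizes; at the stable rank every vertex has a
  -- successor in the same set, which can be iterated.
  obtain ⟨n, hn⟩ := WellFoundedGT.monotone_chain_condition (α := (Set C)ᵒᵈ)
    ⟨fun n => OrderDual.toDual {c | P n c}, ha⟩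
  refine ⟨n, fun c hc => ?_⟩
  have hstep : ∀ c : {c // P n c}, ∃ d : {c // P n c}, r c d := by
    rintro ⟨c, hc⟩
    have : P (n + 1) c := (Set.ext_iff.1 (hn (n + 1) (Nat.le_succ n)) c).1 hc
    obtain ⟨d, hd, h⟩ := (hP _ _).1 this
    exact ⟨⟨d, h⟩, hd⟩
  choose s hs using hstep
  refine ⟨fun k => (s^[k] ⟨c, hc⟩ : {c // P n c}), rfl, fun k => ?_⟩
  simp only [Function.iterate_succ_apply']
  exact hs _

/-- `statePath` grows at its end, while starts of paths call for peeling off the first step. -/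
theorem exists_statePath_succ_iff {A B C : Obj.{u}} (R : FinRel (A.prod C) (B.prod C)) (n : ℕ) :
    ∀ c c', statePath R (n + 1) c c' ↔ ∃ d, stateStep R c d ∧ statePath R n d c' := by
  induction n with
  | zero => intro c c'; simp [statePath, Relation.Comp]
  | succ n ih =>
    intro c c'
    constructor
    · rintro ⟨d, hd, h⟩
      obtain ⟨e, he, h'⟩ := (ih _ _).1 hd
      exact ⟨e, he, d, h', h⟩
    · rintro ⟨e, he, d, hd, h⟩
      exact ⟨d, (ih _ _).2 ⟨e, he, hd⟩, h⟩

/-! ### Futures and pasts of states -/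

section Automaton

variable {A B C : Obj.{u}} (R : FinRel (A.prod C) (B.prod C))

/-- The states reached by reading the left-infinite word `w`, whose last letter is `w 0`. -/
def reach (w : ℕ → A × B) : Set C :=
  {c | ∃ p : ℕ → C, p 0 = c ∧ ∀ n, R ((w n).1, p (n + 1)) ((w n).2, p n)}

/-- The right-infinite words that can be read from a state of `X`. -/
def future (X : Set C) : Set (ℕ → A × B) :=
  {v | ∃ p : ℕ → C, p 0 ∈ X ∧ ∀ n, R ((v n).1, p n) ((v n).2, p (n + 1))}

/-- The states reached from `X` by reading one letter. -/
def successors (X : Set C) (s : A × B) : Set C := {d | ∃ c ∈ X, R (s.1, c) (s.2, d)}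

/-- The infinite word with first letter `s` followed by `v`. -/
def consWord {α : Type*} (s : α) (v : ℕ → α) : ℕ → α
  | 0 => s
  | n + 1 => v n

/-- The bi-infinite word made of `w`, read backwards, on negative positions and of `v`. -/
def glue {α : Type*} (w v : ℕ → α) : ℤ → α
  | .ofNat n => v n
  | .negSucc n => w n

theorem reach_consWord (s : A × B) (w : ℕ → A × B) :
    reach R (consWord s w) = successors R (reach R w) s := by
  ext c
  constructor
  · rintro ⟨p, rfl, hp⟩
    exact ⟨p 1, ⟨fun n => p (n + 1), rfl, fun n => hp (n + 1)⟩, hp 0⟩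
  · rintro ⟨_, ⟨p, rfl, hp⟩, h⟩
    refine ⟨consWord c p, rfl, fun n => ?_⟩
    cases n with
    | zero => exact h
    | succ n => exact hp n

theorem mem_future_successors (X : Set C) (s : A × B) (v : ℕ → A × B) :
    v ∈ future R (successors R X s) ↔ consWord s v ∈ future R X := by
  constructor
  · rintro ⟨p, ⟨c, hc, h⟩, hp⟩
    refine ⟨consWord c p, hc, fun n => ?_⟩
    cases n with
    | zero => exact h
    | succ n => exact hp n
  · rintro ⟨p, h0, hp⟩
    exact ⟨fun n => p (n + 1), ⟨p 0, h0, hp 0⟩, fun n => hp (n + 1)⟩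

/-- The right-infinite words which complete the left-infinite word `w` to a word of `L`. -/
def residual (L : Word A → Word B → Prop) (w : ℕ → A × B) : Set (ℕ → A × B) :=
  {v | L (fun k => (glue w v k).1) (fun k => (glue w v k).2)}

/-- A run on a glued word is cut at its state at position 0, which ends the past and starts the
future. -/
theorem residual_hasRun (w : ℕ → A × B) : residual (HasRun R) w = future R (reach R w) := by
  ext v
  constructor
  · rintro ⟨q, hq⟩
    -- The letter `w n` sits at position -(n+1) and leads to the state at position -n.
    refine ⟨fun n => q n, ⟨fun n => q (-n), by simp, fun n => ?_⟩, fun n => hq n⟩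
    have := hq (Int.negSucc n)
    rw [show Int.negSucc n + 1 = -(n : ℤ) by omega] at this
    exact this
  · rintro ⟨p, ⟨q, h0, hq⟩, hp⟩
    -- The state `q 0` is dropped because it equals `p 0`, already placed at position 0.
    refine ⟨glue (fun n => q (n + 1)) p, fun k => ?_⟩
    match k with
    | .ofNat n => exact hp n
    | .negSucc 0 =>
      have := hq 0
      rw [h0] at this
      exact this
    | .negSucc (n + 1) => exact hq (n + 1)

/-! ### Determinization -/

/-- The states of the determinization: the nonempty sets of states reached by a left-infinite
word. -/
def detObj : Obj.{u} := ⟨{X : Set C // X.Nonempty ∧ ∃ w, X = reach R w}, inferInstance⟩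

/-- The transitions of the determinization. -/
def detRel : FinRel (A.prod (detObj R)) (B.prod (detObj R)) :=
  fun x y => y.2.1 = successors R x.2.1 (x.1, y.1)

/-- The membership relation, a simulation from the determinization. -/
def detSim : FinRel (detObj R) C := fun X c => c ∈ X.1

theorem exists_mem_starts_path (n : ℕ) (X X' : detObj R) (h : statePath (detRel R) n X X') :
    ∃ c ∈ X.1, ∃ c', statePath R n c c' := by
  -- Paths are traced backwards: each element of a successor set has a predecessor in the previous
  -- set.
  suffices H : ∀ c' ∈ X'.1, ∃ c ∈ X.1, statePath R n c c' by
    obtain ⟨c', hc'⟩ := X'.2.1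
    obtain ⟨c, hc, h⟩ := H c' hc'
    exact ⟨c, hc, c', h⟩
  induction n generalizing X' with
  | zero => exact fun c' hc' => ⟨c', (show X = X' from h) ▸ hc', rfl⟩
  | succ n ih =>
    obtain ⟨Y, hY, a, b, hs⟩ := h
    intro c' hc'
    rw [show X'.1 = _ from hs] at hc'
    obtain ⟨d, hd, hstep⟩ := hc'
    obtain ⟨c, hc, hp⟩ := ih Y hY d hd
    exact ⟨c, hc, d, hp, a, b, hstep⟩

/-- In the reversed graph, an infinite path is a run on a left-infinite word. -/
theorem exists_reach_of_ends_path :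
    ∃ n, ∀ c' c, statePath R n c' c → ∃ w, c ∈ reach R w := by
  obtain ⟨n, hn⟩ := exists_infinite_path (r := fun c d => stateStep R d c)
    (P := fun n c => ∃ c', statePath R n c' c) (fun c => ⟨c, rfl⟩) fun n c =>
      ⟨fun ⟨c', d, h, h'⟩ => ⟨d, h', c', h⟩, fun ⟨d, h', c', h⟩ => ⟨c', d, h, h'⟩⟩
  refine ⟨n, fun c' c h => ?_⟩
  obtain ⟨p, h0, hp⟩ := hn c ⟨c', h⟩
  choose a b hab using hp
  exact ⟨fun n => (a n, b n), p, h0, hab⟩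

theorem exists_future_of_starts_path :
    ∃ n, ∀ c c', statePath R n c c' → (future R {c}).Nonempty := by
  obtain ⟨n, hn⟩ := exists_infinite_path (r := stateStep R)
    (P := fun n c => ∃ c', statePath R n c c') (fun c => ⟨c, rfl⟩) fun n c => by
      simp only [exists_statePath_succ_iff]
      grind
  refine ⟨n, fun c c' h => ?_⟩
  obtain ⟨p, h0, hp⟩ := hn c ⟨c', h⟩
  choose a b hab using hp
  exact ⟨fun n => (a n, b n), p, h0, hab⟩

/-- Both sides of the sliding equation say that c' is a successor of some element of X. A state
ending long paths has an infinite past, hence lies in a reached set. Nonemptiness of the sets gives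
the last premise with paths of length 0. -/
theorem isSimulation_detSim : IsSimulation (detRel R) R (detSim R) where
  slide := by
    ext ⟨a, X⟩ ⟨b, c'⟩
    constructor
    · rintro ⟨⟨b', X'⟩, h, rfl, hc'⟩
      have hX' : X'.1 = _ := h
      change c' ∈ X'.1 at hc'
      rw [hX'] at hc'
      obtain ⟨c, hc, hR⟩ := hc'
      exact ⟨(a, c), ⟨rfl, hc⟩, hR⟩
    · rintro ⟨⟨a', c⟩, ⟨rfl, hc⟩, hR⟩
      obtain ⟨w, hw⟩ := X.2.2
      have hc' : c' ∈ successors R X.1 (a, b) := ⟨c, hc, hR⟩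
      refine ⟨(b, ⟨successors R X.1 (a, b), ⟨c', hc'⟩, consWord (a, b) w, ?_⟩), rfl, rfl, hc'⟩
      rw [reach_consWord, hw]
  ends := by
    obtain ⟨n, hn⟩ := exists_reach_of_ends_path R
    refine ⟨n, fun c' c h => ?_⟩
    obtain ⟨w, hw⟩ := hn c' c h
    exact ⟨⟨reach R w, ⟨c, hw⟩, w, rfl⟩, hw⟩
  starts := ⟨0, fun X _ _ => X.2.1⟩

/-! ### The canonical transducer -/

/-- The relation denoted by a transducer has finitely many residuals. -/
theorem finite_residuals :
    Finite {F : Set (ℕ → A × B) // F.Nonempty ∧ ∃ w, F = residual (HasRun R) w} := by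
  -- A residual depends on `w` only through `reach R w`, one of finitely many sets of states.
  refine Set.Finite.subset (Set.finite_range (future R)) ?_
  rintro F ⟨_, w, rfl⟩
  exact ⟨reach R w, (residual_hasRun R w).symm⟩

/-- The states of the canonical transducer: the nonempty residuals. -/
def canonicalObj (L : Word A → Word B → Prop)
    (hL : Finite {F : Set (ℕ → A × B) // F.Nonempty ∧ ∃ w, F = residual L w}) : Obj.{u} :=
  ⟨{F : Set (ℕ → A × B) // F.Nonempty ∧ ∃ w, F = residual L w}, hL⟩

/-- The transitions of the canonical transducer. -/
def canonicalRel (L : Word A → Word B → Prop)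
    (hL : Finite {F : Set (ℕ → A × B) // F.Nonempty ∧ ∃ w, F = residual L w}) :
    FinRel (A.prod (canonicalObj L hL)) (B.prod (canonicalObj L hL)) :=
  fun x y => y.2.1 = {v | consWord (x.1, y.1) v ∈ x.2.1}

/-- The relation between a state of the determinization and its future. -/
def futureSim : FinRel (detObj R) (canonicalObj (HasRun R) (finite_residuals R)) :=
  fun X F => F.1 = future R X.1

/-- Sliding holds because reading a letter commutes with taking futures. A reached set may have an
empty future, which is no canonical state, but then it cannot start arbitrarily long paths. -/
theorem isSimulation_futureSim :
    IsSimulation (detRel R) (canonicalRel (HasRun R) (finite_residuals R)) (futureSim R) where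
  slide := by
    ext ⟨a, X⟩ ⟨b, F'⟩
    constructor
    · rintro ⟨⟨b', X'⟩, h, rfl, hF'⟩
      have hX' : X'.1 = successors R X.1 (a, b') := h
      change F'.1 = future R X'.1 at hF'
      obtain ⟨w, hw⟩ := X.2.2
      have hv : ∀ v, v ∈ F'.1 ↔ consWord (a, b') v ∈ future R X.1 := fun v => by
        rw [hF', hX', mem_future_successors]
      -- Prefixing the letter to a word of F' shows that the future of X is nonempty, hence a state.
      obtain ⟨v, hv'⟩ := F'.2.1
      refine ⟨(a, ⟨future R X.1, ⟨_, (hv v).1 hv'⟩, w, ?_⟩), ⟨rfl, rfl⟩, Set.ext hv⟩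
      rw [residual_hasRun, hw]
    · rintro ⟨⟨a', F⟩, ⟨rfl, hF⟩, h⟩
      change F.1 = future R X.1 at hF
      have hv : F'.1 = future R (successors R X.1 (a, b)) := Set.ext fun v => by
        rw [show F'.1 = {v | consWord (a, b) v ∈ F.1} from h, mem_future_successors, ← hF]
        rfl
      obtain ⟨w, hw⟩ := X.2.2
      obtain ⟨v, hv'⟩ := F'.2.1
      obtain ⟨p, hp, -⟩ := hv ▸ hv'
      refine ⟨(b, ⟨successors R X.1 (a, b), ⟨_, hp⟩, consWord (a, b) w, ?_⟩), rfl, rfl, hv⟩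
      rw [reach_consWord, hw]
  ends := by
    refine ⟨0, fun _ F _ => ?_⟩
    obtain ⟨w, hw⟩ := F.2.2
    rw [residual_hasRun] at hw
    obtain ⟨v, hv⟩ := F.2.1
    obtain ⟨p, hp, -⟩ := hw ▸ hv
    exact ⟨⟨reach R w, ⟨_, hp⟩, w, rfl⟩, hw⟩
  starts := by
    obtain ⟨n, hn⟩ := exists_future_of_starts_path R
    refine ⟨n, fun X X' h => ?_⟩
    obtain ⟨c, hc, c', h'⟩ := exists_mem_starts_path R n X X' h
    obtain ⟨v, p, h0, hp⟩ := hn c c' h'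
    obtain ⟨w, hw⟩ := X.2.2
    refine ⟨⟨future R X.1, ⟨v, p, ?_, hp⟩, w, ?_⟩, rfl⟩
    · rw [show p 0 = c from h0]
      exact hc
    · rw [residual_hasRun, hw]

/-- Keeping `L` and `hL` as parameters gives two transducers with the same relation literally the
same target. -/
theorem derivable_canonical (L : Word A → Word B → Prop)
    (hL : Finite {F : Set (ℕ → A × B) // F.Nonempty ∧ ∃ w, F = residual L w})
    (h : HasRun R = L) :
    Derivable (feedback C (box R)) (feedback _ (box (canonicalRel L hL))) := by
  subst h
  exact (Derivable.symm (.simulation (isSimulation_detSim R))).trans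
    (.simulation (isSimulation_futureSim R))

end Automaton

end ZTrans

theorem mainTheorem1 {A B : ZTrans.Obj.{u}} (R S : ZTrans.Diagram A B)
    (h : R.sem = S.sem) : ZTrans.Derivable R S := by
  obtain ⟨C, T, hT, hT'⟩ := ZTrans.hasNormalForm R
  obtain ⟨D, U, hU, hU'⟩ := ZTrans.hasNormalForm S
  have hTU : ZTrans.HasRun U = ZTrans.HasRun T := by
    funext x y
    exact propext ((hU' x y).symm.trans (h ▸ hT' x y))
  exact hT.trans ((ZTrans.derivable_canonical T _ (ZTrans.finite_residuals T) rfl).trans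
    ((ZTrans.derivable_canonical U _ (ZTrans.finite_residuals T) hTU).symm.trans hU.symm))
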